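/- **Setting.** *Subdivision.* A tile is an oriented 4-cycle with upper left, upper right, lower right and lower left corners $W,Z,Y,X$. Subdividing it creates the midpoints $L,U,R,D$ of its left, top, right and bottom sides $XW, WZ, ZY, YX$ and three inner vertices $A,B,C$, and replaces it by six tiles, written with their corners in the order (upper left, upper right, lower right, lower left): upper left subtile $(W,U,A,L)$, lower left $(X,L,A,C)$, upper right $(Z,R,B,U)$, middle $(A,U,B,C)$, lower right $(Y,C,B,R)$, lower $(Y,D,X,C)$. Two tiles with a common side share the midpoint of that side. A macrotile is a tile together with the result of any number of subdivisions. The eight new edges inside a subdivided macrotile are numbered $1=UA$, $2=UB$, $3=LA$, $4=AC$, $5=BC$, $6=RB$, $7=CX$, $8=CY$. Each has an $A$-face and a $B$-face, lying towards the following subtiles ($A$-face / $B$-face): $1$: upper left / middle; $2$: upper right / middle; $3$: upper left / lower left; $4$: lower left / middle; $5$: lower right / middle; $6$: upper right / lower right; $7$: lower left / lower; $8$: lower right / lower. *Complex.* The complex of level $1$ is a square subdivided once. The complex of level $n+1$ arises from that of level $n$ by subdividing all minimal tiles and then gluing. All vertices of the first complex except the corners of the square have level $0$ (the corners carry no level);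 the vertices created by a subdivision get the maximal level so far plus $1$. Let $k$ be the maximal level after the subdivision. Gluing is performed along every simple path $X_1X_2YZ_2Z_1$ of five vertices such that $X_1,Y,Z_1$ are not three corners of one macrotile, $X_1,Z_1$ are side vertices (midpoints of sides) of level $k-1$, $X_2,Z_2$ are the midpoints of $X_1Y$, $Z_1Y$ and have level $k$, and $Y$ has level $k-2$. A new macrotile, subdivided once, is attached, with upper left corner $Y$, upper right corner $X_1$, lower left corner $Z_1$ and a new lower right corner of level $k-1$ (its other new vertices get level $k$). A *flat part* is the initial square or a glued macrotile; call it $W_0$ as a macrotile. All macrotiles obtained from $W_0$ by subdivisions belong to this flat part. *Types.* The sides of $W_0$ are the border edges $left, top, right, bottom$. Every side of a macrotile $T$ of the flat part lies either on a side of $W_0$ (border type), or on one of the eight inner edges $k$ of some macrotile containing $T$, with $T$ at the $A$- or the $B$-face of it (inner type $kA$ or $kB$). A macrotile is a *direct descendant* of another one if it is obtained from it by passing one or more times to the upper left subtile. **Statement.** Fix a flat part $W_0$. Every macrotile $T$ of it (at any level of the complex) has exactly one quadruple $(l,t,r,b)$ of types of its left, top, right and bottom sides. **(A)** The quadruples of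 macrotiles of the flat part whose types $l,t$ are both inner are exactly the following: A1. $(7A,t,3B,4A)$ and A2. $(7A,t,1A,3A)$, for any inner type $t$; A3. $(8B,t,t,7B)$, A4. $(8B,t,1A,3A)$, A5. $(t,t,6A,2A)$ and A6. $(t,t,1A,3A)$, for $t\in\{2A,3A,4A,5B,6B,7B\}$; A7. $(l,1A,6A,2A)$ and A8. $(l,1A,1A,3A)$, for any inner $l$; A9. $(4B,1B,2B,5B)$; A10. $(4B,1B,1A,3A)$; A11. $(1B,2B,6A,2A)$; A12. $(1B,2B,1A,3A)$; A13. $(l,3B,6A,2A)$ and A14. $(l,3B,1A,3A)$, for any inner $l$; A15. $(8A,5A,6A,2A)$; A16. $(8A,5A,1A,3A)$; A17. $(l,6A,6A,2A)$, A18. $(l,6A,1A,3A)$, A19. $(l,8A,5A,6B)$ and A20. $(l,8A,1A,3A)$, for any inner $l$ except $1B,4B,7A,8A,8B$. **(B)** The quadruples of macrotiles of the flat part for which at least one of $l,t$ is a border type are exactly the following ($x$ in B3, B4, B11, B12, B17, B18 is any of $left,top,right,bottom$): B1. $(left,top,right,bottom)$; B2. $(left,top,1A,3A)$; B3. $(7A,x,3B,4A)$;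 B4. $(7A,x,1A,3A)$; B5. $(top,right,6A,2A)$; B6. $(top,right,1A,3A)$; B7. $(x,8A,5A,6B)$ and B8. $(x,8A,1A,3A)$, for $x\in\{right,bottom\}$; B9. $(8B,bottom,bottom,7B)$; B10. $(8B,bottom,1A,3A)$; B11. $(x,3B,6A,2A)$; B12. $(x,3B,1A,3A)$; B13. $(right,6A,6A,2A)$; B14. $(right,6A,1A,3A)$; B15. $(bottom,6A,6A,2A)$; B16. $(bottom,6A,1A,3A)$; B17. $(x,1A,6A,2A)$; B18. $(x,1A,1A,3A)$; B19. $(bottom,bottom,6A,2A)$; B20. $(bottom,bottom,1A,3A)$. Moreover, the quadruples in (B) arise as follows. 1. $W_0$ itself has the quadruple $(left,top,right,bottom)$. 2. The immediate subtiles of $W_0$ other than the middle one have the quadruples: lower left $(7A,left,3B,4A)$, upper left $(left,top,1A,3A)$, upper right $(top,right,6A,2A)$, lower right $(right,8A,5A,6B)$, lower $(8B,bottom,bottom,7B)$. 3. Every direct descendant of such an immediate subtile has the quadruple: lower left $(7A,left,1A,3A)$, upper left $(left,top,1A,3A)$, upper right $(top,right,1A,3A)$, lower right $(right,8A,1A,3A)$,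 lower $(8B,bottom,1A,3A)$. 4. The quadruples of the remaining macrotiles (neither $W_0$, nor its immediate subtiles, nor direct descendants of these) whose type $l$ is a border type are exactly $(l,3B,6A,2A)$, $(l,1A,6A,2A)$, $(l,3B,1A,3A)$, $(l,1A,1A,3A)$ with $l\in\{left,top,right,bottom\}$; $(l,6A,6A,2A)$, $(l,6A,1A,3A)$ with $l\in\{right,bottom\}$; $(bottom,bottom,6A,2A)$, $(bottom,bottom,1A,3A)$, $(bottom,8A,5A,6B)$, $(bottom,8A,1A,3A)$. 5. The quadruples of the remaining macrotiles whose type $t$ is a border type are exactly $(7A,t,3B,4A)$, $(7A,t,1A,3A)$ with $t\in\{left,top,right,bottom\}$; $(bottom,bottom,6A,2A)$, $(bottom,bottom,1A,3A)$. -/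

import Mathlib

namespace MacroTiling

/-! ### Vertices and tiles -/

/-- The four corners of a tile. -/
inductive Corner
  | ul | ur | dr | dl
  deriving DecidableEq

/-- The three inner (black) vertices created inside a tile when it is subdivided. -/
inductive InnerKind
  | A | B | C
  deriving DecidableEq

/-- Names of the vertices of the complex: the corners of the initial square, the midpoint of an
edge (see `midV`), the inner vertices of a tile with the given corners, and the new corner
opposite to `y` of the macrotile glued along the path through `x`, `y`, `z`. -/
inductive Vertex
  | base (c : Corner)
  | mid (a b : Vertex)
  | inner (k : InnerKind) (ul ur dr dl : Vertex)
  | glued (x y z : Vertex)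
  deriving DecidableEq

/-- The midpoint of an (unoriented) edge. -/
noncomputable def midV (e : Sym2 Vertex) : Vertex :=
  Vertex.mid (Quot.out e).1 (Quot.out e).2

/-- The four sides of an oriented tile. -/
inductive Side
  | left | top | right | bottom
  deriving DecidableEq

/-- An oriented (macro)tile, given by its corners. -/
structure Tile where
  ul : Vertex
  ur : Vertex
  dr : Vertex
  dl : Vertex

namespace Tile

def corner (T : Tile) : Corner → Vertex
  | .ul => T.ul
  | .ur => T.ur
  | .dr => T.dr
  | .dl => T.dl

/-- The sides of a tile, as unoriented (macro)edges. -/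
def side (T : Tile) : Side → Sym2 Vertex
  | .left => s(T.dl, T.ul)
  | .top => s(T.ul, T.ur)
  | .right => s(T.ur, T.dr)
  | .bottom => s(T.dr, T.dl)

/-- Midpoint of the left side. -/
noncomputable def L (T : Tile) : Vertex := midV (T.side .left)
/-- Midpoint of the top side. -/
noncomputable def U (T : Tile) : Vertex := midV (T.side .top)
/-- Midpoint of the right side. -/
noncomputable def R (T : Tile) : Vertex := midV (T.side .right)
/-- Midpoint of the bottom side. -/
noncomputable def D (T : Tile) : Vertex := midV (T.side .bottom)

/-- The inner vertices of the subdivided tile. -/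
def inn (T : Tile) (k : InnerKind) : Vertex := Vertex.inner k T.ul T.ur T.dr T.dl

end Tile

/-- The six positions of a subtile in its parent macrotile. -/
inductive Pos
  | upperLeft | lowerLeft | upperRight | middle | lowerRight | lower
  deriving DecidableEq

/-- The subdivision rule. The six subtiles are listed with their orientations: the fields are, in
this order, the upper left, upper right, lower right and lower left corner of the subtile. -/
noncomputable def Tile.sub (T : Tile) : Pos → Tile
  | .upperLeft => ⟨T.ul, T.U, T.inn .A, T.L⟩
  | .lowerLeft => ⟨T.dl, T.L, T.inn .A, T.inn .C⟩
  | .upperRight => ⟨T.ur, T.R, T.inn .B, T.U⟩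
  | .middle => ⟨T.inn .A, T.U, T.inn .B, T.inn .C⟩
  | .lowerRight => ⟨T.dr, T.inn .C, T.inn .B, T.R⟩
  | .lower => ⟨T.dr, T.D, T.dl, T.inn .C⟩

/-- The macrotile reached from `T` by passing successively to the subtiles in the listed
positions (the first entry of the list is the first passage). -/
noncomputable def Tile.descend (T : Tile) (p : List Pos) : Tile := p.foldl Tile.sub T

/-! ### The complex -/

/-- Levels of vertices. The corners of the initial square carry no level; the value `-1` only
marks them, so that all other vertices of the first complex get level `0`. -/
def Vertex.level : Vertex → ℤ
  | .base _ => -1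
  | .mid a b => max a.level b.level + 1
  | .inner _ p q r s => max (max p.level q.level) (max r.level s.level) + 1
  | .glued x _ _ => x.level

/-- Side (white) vertices: the midpoints of sides. -/
def Vertex.IsSideVertex : Vertex → Prop
  | .mid _ _ => True
  | _ => False

/-- A flat part of a complex: a macrotile (the initial square or a glued macrotile) that has been
subdivided `depth` times. -/
structure FlatPart where
  root : Tile
  depth : ℕ

/-- A complex, as the collection of its flat parts; flat parts are attached to each other through
common vertices. -/
abbrev Complex := Set FlatPart

namespace Complex

/-- The minimal tiles of a complex. -/
def minimalTiles (K : Complex) : Set Tile :=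
  {T | ∃ F ∈ K, ∃ p : List Pos, p.length = F.depth ∧ T = F.root.descend p}

/-- All macrotiles of a complex, minimal tiles included. -/
def macrotiles (K : Complex) : Set Tile :=
  {T | ∃ F ∈ K, ∃ p : List Pos, p.length ≤ F.depth ∧ T = F.root.descend p}

def vertices (K : Complex) : Set Vertex :=
  {v | ∃ T ∈ K.minimalTiles, ∃ c, v = T.corner c}

/-- Adjacency in the graph of the complex: the edges are the sides of the minimal tiles. -/
def Adj (K : Complex) (a b : Vertex) : Prop :=
  ∃ T ∈ K.minimalTiles, ∃ i, T.side i = s(a, b)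

/-- Subdivision of all minimal tiles. -/
def subdivide (K : Complex) : Complex :=
  (fun F : FlatPart => ⟨F.root, F.depth + 1⟩) '' K

/-- The paths `x₁ x₂ y z₂ z₁` along which a macrotile is glued. -/
structure IsGluingPath (K : Complex) (x₁ x₂ y z₂ z₁ : Vertex) : Prop where
  nodup : [x₁, x₂, y, z₂, z₁].Nodup
  adj₁ : K.Adj x₁ x₂
  adj₂ : K.Adj x₂ y
  adj₃ : K.Adj y z₂
  adj₄ : K.Adj z₂ z₁
  not_corners : ¬ ∃ T ∈ K.macrotiles,
    (∃ c, T.corner c = x₁) ∧ (∃ c, T.corner c = y) ∧ (∃ c, T.corner c = z₁)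
  side_x : x₁.IsSideVertex
  side_z : z₁.IsSideVertex
  mid_x : x₂ = midV s(x₁, y)
  mid_z : z₂ = midV s(z₁, y)
  /-- `y` carries a level, i.e. it is not a corner of the initial square. -/
  level_y_nonneg : 0 ≤ y.level
  levels : ∃ k : ℤ, IsGreatest (Vertex.level '' K.vertices) k ∧
    x₁.level = k - 1 ∧ z₁.level = k - 1 ∧ x₂.level = k ∧ z₂.level = k ∧ y.level = k - 2

/-- The macrotile glued along a path `x₁ x₂ y z₂ z₁`: its top side is `y x₁`, its left side is
`y z₁`, its lower right corner is new. -/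
def gluedTile (x₁ y z₁ : Vertex) : Tile := ⟨y, x₁, Vertex.glued x₁ y z₁, z₁⟩

/-- Gluing: a new macrotile, subdivided once, is attached along every gluing path. -/
def glue (K : Complex) : Complex :=
  K ∪ {F | ∃ x₁ x₂ y z₂ z₁, K.IsGluingPath x₁ x₂ y z₂ z₁ ∧ F = ⟨gluedTile x₁ y z₁, 1⟩}

end Complex

/-- The initial square. -/
def baseTile : Tile := ⟨.base .ul, .base .ur, .base .dr, .base .dl⟩

/-- `complexOf n` is the complex of level `n + 1`: the first one is the initial square subdivided
once, each next one arises by subdivision followed by gluing. -/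
def complexOf : ℕ → Complex
  | 0 => {⟨baseTile, 1⟩}
  | n + 1 => (complexOf n).subdivide.glue

/-- `W` is the initial square or a glued macrotile of some complex. -/
def IsFlatRoot (W : Tile) : Prop := ∃ n, ∃ F ∈ complexOf n, F.root = W

/-- The address `p` inside the flat part with root `W` is that of a macrotile of `complexOf n`. -/
def IsMacrotile (n : ℕ) (W : Tile) (p : List Pos) : Prop :=
  ∃ F ∈ complexOf n, F.root = W ∧ p.length ≤ F.depth

/-! ### Types of edges -/

/-- The eight edges inside a subdivided macrotile. -/
inductive InnerEdge
  | e1 | e2 | e3 | e4 | e5 | e6 | e7 | e8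
  deriving DecidableEq

/-- The two faces of an inner edge. -/
inductive Face
  | A | B
  deriving DecidableEq

noncomputable def Tile.innerEdge (T : Tile) : InnerEdge → Sym2 Vertex
  | .e1 => s(T.U, T.inn .A)
  | .e2 => s(T.U, T.inn .B)
  | .e3 => s(T.L, T.inn .A)
  | .e4 => s(T.inn .A, T.inn .C)
  | .e5 => s(T.inn .B, T.inn .C)
  | .e6 => s(T.R, T.inn .B)
  | .e7 => s(T.inn .C, T.dl)
  | .e8 => s(T.inn .C, T.dr)

/-- The subtile lying at the given face of an inner edge. -/
def facing : InnerEdge → Face → Pos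
  | .e1, .A => .upperLeft
  | .e1, .B => .middle
  | .e2, .A => .upperRight
  | .e2, .B => .middle
  | .e3, .A => .upperLeft
  | .e3, .B => .lowerLeft
  | .e4, .A => .lowerLeft
  | .e4, .B => .middle
  | .e5, .A => .lowerRight
  | .e5, .B => .middle
  | .e6, .A => .upperRight
  | .e6, .B => .lowerRight
  | .e7, .A => .lowerLeft
  | .e7, .B => .lower
  | .e8, .A => .lowerRight
  | .e8, .B => .lower

/-- Types of edges: `16` inner types and `4` border types. -/
inductive EdgeType
  | inner (k : InnerEdge) (f : Face)
  | border (s : Side)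
  deriving DecidableEq

def EdgeType.IsInner (t : EdgeType) : Prop := ∃ k f, t = .inner k f
def EdgeType.IsBorder (t : EdgeType) : Prop := ∃ s, t = .border s

/-- `LiesOn e f`: the macroedge `f` is a part of the macroedge `e`, obtained by repeated
halving. -/
inductive LiesOn (e : Sym2 Vertex) : Sym2 Vertex → Prop
  | refl : LiesOn e e
  | half {a b : Vertex} : LiesOn e s(a, b) → LiesOn e s(a, midV s(a, b))

/-- The side `i` of the macrotile with address `p` in the flat part with root `W` has the given
type: it lies on a side of `W`, or on an inner edge `k` of a macrotile containing it, the given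
macrotile being inside the subtile at the face `f` of this edge. -/
def HasType (W : Tile) (p : List Pos) (i : Side) : EdgeType → Prop
  | .border s => LiesOn (W.side s) ((W.descend p).side i)
  | .inner k f => ∃ p₀ p₁ : List Pos, p = p₀ ++ facing k f :: p₁ ∧
      LiesOn ((W.descend p₀).innerEdge k) ((W.descend p).side i)

/-- A quadruple of edge types (left, top, right, bottom). -/
@[ext] structure Env where
  left : EdgeType
  top : EdgeType
  right : EdgeType
  bottom : EdgeType
  deriving DecidableEq

/-- `q` is the quadruple of types of the boundary edges of the macrotile. -/
def HasEnv (W : Tile) (p : List Pos) (q : Env) : Prop :=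
  HasType W p .left q.left ∧ HasType W p .top q.top ∧
    HasType W p .right q.right ∧ HasType W p .bottom q.bottom

/-- `IsDirectDescendant p r`: the macrotile with address `r` is obtained from the one with address
`p` by passing, one or more times, to the upper left subtile. -/
inductive IsDirectDescendant (p : List Pos) : List Pos → Prop
  | sub : IsDirectDescendant p (p ++ [.upperLeft])
  | step {r : List Pos} : IsDirectDescendant p r → IsDirectDescendant p (r ++ [.upperLeft])

/-! ### The lists of quadruples -/

abbrev t1A : EdgeType := .inner .e1 .A
abbrev t1B : EdgeType := .inner .e1 .B
abbrev t2A : EdgeType := .inner .e2 .A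
abbrev t2B : EdgeType := .inner .e2 .B
abbrev t3A : EdgeType := .inner .e3 .A
abbrev t3B : EdgeType := .inner .e3 .B
abbrev t4A : EdgeType := .inner .e4 .A
abbrev t4B : EdgeType := .inner .e4 .B
abbrev t5A : EdgeType := .inner .e5 .A
abbrev t5B : EdgeType := .inner .e5 .B
abbrev t6A : EdgeType := .inner .e6 .A
abbrev t6B : EdgeType := .inner .e6 .B
abbrev t7A : EdgeType := .inner .e7 .A
abbrev t7B : EdgeType := .inner .e7 .B
abbrev t8A : EdgeType := .inner .e8 .A
abbrev t8B : EdgeType := .inner .e8 .B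
abbrev bLeft : EdgeType := .border .left
abbrev bTop : EdgeType := .border .top
abbrev bRight : EdgeType := .border .right
abbrev bBottom : EdgeType := .border .bottom

/-- The twenty cases with inner left and top edges. -/
inductive CaseA : Env → Prop
  | A1 (t : EdgeType) : t.IsInner → CaseA ⟨t7A, t, t3B, t4A⟩
  | A2 (t : EdgeType) : t.IsInner → CaseA ⟨t7A, t, t1A, t3A⟩
  | A3 (t : EdgeType) : t ∈ [t2A, t3A, t4A, t5B, t6B, t7B] → CaseA ⟨t8B, t, t, t7B⟩
  | A4 (t : EdgeType) : t ∈ [t2A, t3A, t4A, t5B, t6B, t7B] → CaseA ⟨t8B, t, t1A, t3A⟩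
  | A5 (t : EdgeType) : t ∈ [t2A, t3A, t4A, t5B, t6B, t7B] → CaseA ⟨t, t, t6A, t2A⟩
  | A6 (t : EdgeType) : t ∈ [t2A, t3A, t4A, t5B, t6B, t7B] → CaseA ⟨t, t, t1A, t3A⟩
  | A7 (l : EdgeType) : l.IsInner → CaseA ⟨l, t1A, t6A, t2A⟩
  | A8 (l : EdgeType) : l.IsInner → CaseA ⟨l, t1A, t1A, t3A⟩
  | A9 : CaseA ⟨t4B, t1B, t2B, t5B⟩
  | A10 : CaseA ⟨t4B, t1B, t1A, t3A⟩
  | A11 : CaseA ⟨t1B, t2B, t6A, t2A⟩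
  | A12 : CaseA ⟨t1B, t2B, t1A, t3A⟩
  | A13 (l : EdgeType) : l.IsInner → CaseA ⟨l, t3B, t6A, t2A⟩
  | A14 (l : EdgeType) : l.IsInner → CaseA ⟨l, t3B, t1A, t3A⟩
  | A15 : CaseA ⟨t8A, t5A, t6A, t2A⟩
  | A16 : CaseA ⟨t8A, t5A, t1A, t3A⟩
  | A17 (l : EdgeType) : l.IsInner → l ∉ [t1B, t4B, t7A, t8A, t8B] → CaseA ⟨l, t6A, t6A, t2A⟩
  | A18 (l : EdgeType) : l.IsInner → l ∉ [t1B, t4B, t7A, t8A, t8B] → CaseA ⟨l, t6A, t1A, t3A⟩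
  | A19 (l : EdgeType) : l.IsInner → l ∉ [t1B, t4B, t7A, t8A, t8B] → CaseA ⟨l, t8A, t5A, t6B⟩
  | A20 (l : EdgeType) : l.IsInner → l ∉ [t1B, t4B, t7A, t8A, t8B] → CaseA ⟨l, t8A, t1A, t3A⟩

/-- The twenty cases in which the left or the top edge is a border edge. -/
inductive CaseB : Env → Prop
  | B1 : CaseB ⟨bLeft, bTop, bRight, bBottom⟩
  | B2 : CaseB ⟨bLeft, bTop, t1A, t3A⟩
  | B3 (x : EdgeType) : x.IsBorder → CaseB ⟨t7A, x, t3B, t4A⟩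
  | B4 (x : EdgeType) : x.IsBorder → CaseB ⟨t7A, x, t1A, t3A⟩
  | B5 : CaseB ⟨bTop, bRight, t6A, t2A⟩
  | B6 : CaseB ⟨bTop, bRight, t1A, t3A⟩
  | B7 (x : EdgeType) : x ∈ [bRight, bBottom] → CaseB ⟨x, t8A, t5A, t6B⟩
  | B8 (x : EdgeType) : x ∈ [bRight, bBottom] → CaseB ⟨x, t8A, t1A, t3A⟩
  | B9 : CaseB ⟨t8B, bBottom, bBottom, t7B⟩
  | B10 : CaseB ⟨t8B, bBottom, t1A, t3A⟩
  | B11 (x : EdgeType) : x.IsBorder → CaseB ⟨x, t3B, t6A, t2A⟩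
  | B12 (x : EdgeType) : x.IsBorder → CaseB ⟨x, t3B, t1A, t3A⟩
  | B13 : CaseB ⟨bRight, t6A, t6A, t2A⟩
  | B14 : CaseB ⟨bRight, t6A, t1A, t3A⟩
  | B15 : CaseB ⟨bBottom, t6A, t6A, t2A⟩
  | B16 : CaseB ⟨bBottom, t6A, t1A, t3A⟩
  | B17 (x : EdgeType) : x.IsBorder → CaseB ⟨x, t1A, t6A, t2A⟩
  | B18 (x : EdgeType) : x.IsBorder → CaseB ⟨x, t1A, t1A, t3A⟩
  | B19 : CaseB ⟨bBottom, bBottom, t6A, t2A⟩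
  | B20 : CaseB ⟨bBottom, bBottom, t1A, t3A⟩

/-- Quadruples of the immediate subtiles of the root that touch the border. -/
inductive SubEnv : Pos → Env → Prop
  | lowerLeft : SubEnv .lowerLeft ⟨t7A, bLeft, t3B, t4A⟩
  | upperLeft : SubEnv .upperLeft ⟨bLeft, bTop, t1A, t3A⟩
  | upperRight : SubEnv .upperRight ⟨bTop, bRight, t6A, t2A⟩
  | lowerRight : SubEnv .lowerRight ⟨bRight, t8A, t5A, t6B⟩
  | lower : SubEnv .lower ⟨t8B, bBottom, bBottom, t7B⟩

/-- Quadruples of the direct descendants of these immediate subtiles. -/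
inductive DescEnv : Pos → Env → Prop
  | lowerLeft : DescEnv .lowerLeft ⟨t7A, bLeft, t1A, t3A⟩
  | upperLeft : DescEnv .upperLeft ⟨bLeft, bTop, t1A, t3A⟩
  | upperRight : DescEnv .upperRight ⟨bTop, bRight, t1A, t3A⟩
  | lowerRight : DescEnv .lowerRight ⟨bRight, t8A, t1A, t3A⟩
  | lower : DescEnv .lower ⟨t8B, bBottom, t1A, t3A⟩

/-- The address is neither that of the root, nor of an immediate subtile of the root, nor of a
direct descendant of an immediate subtile. -/
def IsRemaining (p : List Pos) : Prop :=
  p ≠ [] ∧ ∀ c : Pos, p ≠ [c] ∧ ¬ IsDirectDescendant [c] p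

/-- Quadruples of the remaining macrotiles touching the border by their left side. -/
inductive LeftEnv : Env → Prop
  | c1 (l : EdgeType) : l.IsBorder → LeftEnv ⟨l, t3B, t6A, t2A⟩
  | c2 (l : EdgeType) : l.IsBorder → LeftEnv ⟨l, t1A, t6A, t2A⟩
  | c3 (l : EdgeType) : l.IsBorder → LeftEnv ⟨l, t3B, t1A, t3A⟩
  | c4 (l : EdgeType) : l.IsBorder → LeftEnv ⟨l, t1A, t1A, t3A⟩
  | c5 (l : EdgeType) : l ∈ [bRight, bBottom] → LeftEnv ⟨l, t6A, t6A, t2A⟩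
  | c6 (l : EdgeType) : l ∈ [bRight, bBottom] → LeftEnv ⟨l, t6A, t1A, t3A⟩
  | c7 : LeftEnv ⟨bBottom, bBottom, t6A, t2A⟩
  | c8 : LeftEnv ⟨bBottom, bBottom, t1A, t3A⟩
  | c9 : LeftEnv ⟨bBottom, t8A, t5A, t6B⟩
  | c10 : LeftEnv ⟨bBottom, t8A, t1A, t3A⟩

/-- Quadruples of the remaining macrotiles touching the border by their top side. -/
inductive TopEnv : Env → Prop
  | c1 (t : EdgeType) : t.IsBorder → TopEnv ⟨t7A, t, t3B, t4A⟩
  | c2 (t : EdgeType) : t.IsBorder → TopEnv ⟨t7A, t, t1A, t3A⟩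
  | c3 : TopEnv ⟨bBottom, bBottom, t6A, t2A⟩
  | c4 : TopEnv ⟨bBottom, bBottom, t1A, t3A⟩

end MacroTiling

open MacroTiling

/-! A side of a subtile is either a half of a side of its parent, whose type it inherits, or one of
the eight inner edges of the parent, seen from a known face (`sub_side`). Hence the quadruple of a
subtile depends only on its position and on the quadruple of the parent: the quadruples run through
a finite automaton with transitions `Env.sub` and start state `rootEnv`. By induction on the
address, `envAt` is one admissible quadruple (`hasType_envAt`).

It is the only one because of levels (`HasType.eq_envAt`). In a flat part all sides of a macrotile
at depth `d` have level `m + d` for one fixed `m` (`Tile.Regular.descend`), and halving raises the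
level by one. A half of a macroedge has the midpoint as its only end of maximal level, while every
inner edge has an inner vertex of maximal level, so inner edges are never halves
(`innerEdge_ne_half`). A chain of halvings can therefore be undone in one way only, and the inner
edge or border side at its start is determined.

What remains is to find the reachable states. The root, its subtiles and their direct descendants
give finitely many states. All other macrotiles are closed under subdivision; their states stay in
the finite list `remEnvs` by a finite check, and each entry of the list is reached by a short
address followed by explicit passages (`isRemainingEnv_iff`). The tables of the theorem are then
obtained by sorting according to whether the left and top types are inner or border. -/

namespace MacroTiling

/-! ### Levels of macroedges -/

/-- The level of a macroedge: the larger one of the levels of its ends. -/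
def edgeLevel : Sym2 Vertex → ℤ :=
  Sym2.lift ⟨fun a b => max a.level b.level, fun _ _ => max_comm _ _⟩

@[simp] lemma edgeLevel_mk (a b : Vertex) : edgeLevel s(a, b) = max a.level b.level := rfl

lemma mk_out (e : Sym2 Vertex) : s((Quot.out e).1, (Quot.out e).2) = e := Quot.out_eq e

lemma level_midV (e : Sym2 Vertex) : (midV e).level = edgeLevel e + 1 := by
  conv_rhs => rw [← mk_out e]
  rfl

lemma midV_injective : Function.Injective midV := by
  intro e f h
  simp only [midV, Vertex.mid.injEq] at h
  rw [← mk_out e, ← mk_out f, h.1, h.2]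

lemma midV_ne_inner (e : Sym2 Vertex) (k : InnerKind) (p q r s : Vertex) :
    midV e ≠ Vertex.inner k p q r s := by
  simp [midV]

lemma edgeLevel_half (a b : Vertex) :
    edgeLevel s(a, midV s(a, b)) = edgeLevel s(a, b) + 1 := by
  simp only [edgeLevel_mk, level_midV]
  omega

/-- In the crossed matching of the ends each midpoint would be an end of the other edge, so each
edge would have a larger level than the other. -/
lemma half_injective {a b c d : Vertex} (h : s(a, midV s(a, b)) = s(c, midV s(c, d))) :
    s(a, b) = s(c, d) := by
  rcases Sym2.eq_iff.1 h with ⟨-, h⟩ | ⟨h₁, h₂⟩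
  · exact midV_injective h
  · have h₃ := congrArg Vertex.level h₁
    have h₄ := congrArg Vertex.level h₂
    simp only [edgeLevel_mk, level_midV] at h₃ h₄
    omega

lemma LiesOn.edgeLevel_le {e f : Sym2 Vertex} (h : LiesOn e f) : edgeLevel e ≤ edgeLevel f := by
  induction h with
  | refl => exact le_rfl
  | half _ ih => rw [edgeLevel_half]; omega

lemma LiesOn.eq_of_edgeLevel_eq {e f : Sym2 Vertex} (h : LiesOn e f)
    (hl : edgeLevel f ≤ edgeLevel e) : e = f := by
  cases h with
  | refl => rfl
  | half h => rw [edgeLevel_half] at hl; have := h.edgeLevel_le; omega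

/-- By `half_injective` the last halving in a chain can only have been applied to `s(a, b)`. -/
lemma LiesOn.of_half {e : Sym2 Vertex} {a b : Vertex} (h : LiesOn e s(a, midV s(a, b)))
    (hne : e ≠ s(a, midV s(a, b))) : LiesOn e s(a, b) := by
  generalize hf : s(a, midV s(a, b)) = f at h hne
  cases h with
  | refl => exact absurd rfl hne
  | half h => rwa [half_injective hf]

/-- If a half of a macroedge contains an inner vertex, then so does the macroedge. -/
lemma edgeLevel_half_of_mem_inner {a b : Vertex} {k : InnerKind} {p q r s : Vertex}
    (h : Vertex.inner k p q r s ∈ s(a, midV s(a, b))) :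
    (Vertex.inner k p q r s).level < edgeLevel s(a, midV s(a, b)) := by
  rcases Sym2.mem_iff.1 h with h | h
  · rw [edgeLevel_half, h, edgeLevel_mk]; omega
  · exact absurd h.symm (midV_ne_inner _ _ _ _ _ _)

/-! ### Macrotiles whose sides have equal levels -/

/-- The corners of the tile are distinct and all its sides have level `m`. -/
structure Tile.Regular (T : Tile) (m : ℤ) : Prop where
  ul_ne_ur : T.ul ≠ T.ur
  ul_ne_dr : T.ul ≠ T.dr
  ul_ne_dl : T.ul ≠ T.dl
  ur_ne_dr : T.ur ≠ T.dr
  ur_ne_dl : T.ur ≠ T.dl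
  dr_ne_dl : T.dr ≠ T.dl
  edgeLevel_side : ∀ i, edgeLevel (T.side i) = m

namespace Tile.Regular

variable {T : Tile} {m : ℤ}

lemma max_top (h : T.Regular m) : max T.ul.level T.ur.level = m := h.edgeLevel_side .top
lemma max_bottom (h : T.Regular m) : max T.dr.level T.dl.level = m := h.edgeLevel_side .bottom

lemma level_L (h : T.Regular m) : T.L.level = m + 1 := by
  rw [Tile.L, level_midV, h.edgeLevel_side]
lemma level_U (h : T.Regular m) : T.U.level = m + 1 := by
  rw [Tile.U, level_midV, h.edgeLevel_side]
lemma level_R (h : T.Regular m) : T.R.level = m + 1 := by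
  rw [Tile.R, level_midV, h.edgeLevel_side]
lemma level_D (h : T.Regular m) : T.D.level = m + 1 := by
  rw [Tile.D, level_midV, h.edgeLevel_side]

lemma level_inn (h : T.Regular m) (k : InnerKind) : (T.inn k).level = m + 1 := by
  have h₁ := h.max_top
  have h₂ := h.max_bottom
  simp only [Tile.inn, Vertex.level]
  omega

lemma side_injective (h : T.Regular m) : Function.Injective T.side := by
  have h₁ := h.ul_ne_ur
  have h₂ := h.ul_ne_dr
  have h₃ := h.ul_ne_dl
  have h₄ := h.ur_ne_dr
  have h₅ := h.ur_ne_dl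
  have h₆ := h.dr_ne_dl
  intro i j
  cases i <;> cases j <;> simp [Tile.side] <;> grind

lemma corner_ne (h : T.Regular m) {v : Vertex} (hv : v.level = m + 1) :
    T.ul ≠ v ∧ T.ur ≠ v ∧ T.dr ≠ v ∧ T.dl ≠ v := by
  have h₁ := h.max_top
  have h₂ := h.max_bottom
  refine ⟨?_, ?_, ?_, ?_⟩ <;> rintro rfl <;> omega

lemma inn_ne_midV (k : InnerKind) (e : Sym2 Vertex) : T.inn k ≠ midV e :=
  (midV_ne_inner _ _ _ _ _ _).symm

lemma inn_injective : Function.Injective T.inn := fun k l h => by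
  simpa [Tile.inn] using h

/-- Every side of a subtile has a new end, of level `m + 1`, and the old corners have level at most
`m`. The same gap separates new vertices from old ones; new vertices differ from each other because
the sides of `T` are distinct and midpoints are never inner vertices. -/
lemma sub (h : T.Regular m) (c : Pos) : (T.sub c).Regular (m + 1) := by
  have hL := h.corner_ne h.level_L
  have hU := h.corner_ne h.level_U
  have hR := h.corner_ne h.level_R
  have hD := h.corner_ne h.level_D
  have hI := fun k => h.corner_ne (h.level_inn k)
  have mL := fun k => inn_ne_midV (T := T) k (T.side .left)
  have mU := fun k => inn_ne_midV (T := T) k (T.side .top)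
  have mR := fun k => inn_ne_midV (T := T) k (T.side .right)
  have mD := fun k => inn_ne_midV (T := T) k (T.side .bottom)
  have hm : ∀ i j, i ≠ j → midV (T.side i) ≠ midV (T.side j) := fun i j hij hh =>
    hij (h.side_injective (midV_injective hh))
  have h₁ := hm .left .top (by decide)
  have h₂ := hm .top .right (by decide)
  have hk : ∀ k l, k ≠ l → T.inn k ≠ T.inn l := fun k l hkl hh => hkl (inn_injective hh)
  have k₁ := hk .A .B (by decide)
  have k₂ := hk .A .C (by decide)
  have k₃ := hk .B .C (by decide)
  have h₆ := h.dr_ne_dl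
  have l₁ := h.max_top
  have l₂ := h.max_bottom
  have lL := h.level_L
  have lU := h.level_U
  have lR := h.level_R
  have lD := h.level_D
  have lI := h.level_inn
  simp only [Tile.L, Tile.U, Tile.R, Tile.D] at *
  constructor
  case edgeLevel_side =>
    intro i
    cases c <;> cases i <;>
      simp only [Tile.sub, Tile.side, Tile.L, Tile.U, Tile.R, Tile.D, edgeLevel_mk] at * <;>
      simp only [lL, lU, lR, lD, lI] <;> omega
  all_goals
    cases c <;> simp only [Tile.sub, Tile.L, Tile.U, Tile.R, Tile.D] <;> grind

lemma inn_mem_innerEdge (T : Tile) (k : InnerEdge) : ∃ i, T.inn i ∈ T.innerEdge k := by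
  cases k
  exacts [⟨.A, by simp [Tile.innerEdge]⟩, ⟨.B, by simp [Tile.innerEdge]⟩,
    ⟨.A, by simp [Tile.innerEdge]⟩, ⟨.A, by simp [Tile.innerEdge]⟩,
    ⟨.B, by simp [Tile.innerEdge]⟩, ⟨.B, by simp [Tile.innerEdge]⟩,
    ⟨.C, by simp [Tile.innerEdge]⟩, ⟨.C, by simp [Tile.innerEdge]⟩]

lemma edgeLevel_innerEdge (h : T.Regular m) (k : InnerEdge) :
    edgeLevel (T.innerEdge k) = m + 1 := by
  have l₂ := h.max_bottom
  cases k <;>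
    simp only [Tile.innerEdge, edgeLevel_mk, h.level_inn, h.level_L, h.level_U, h.level_R] <;>
    omega

/-- An inner edge is not a half of a macroedge. -/
lemma innerEdge_ne_half (h : T.Regular m) (k : InnerEdge) (a b : Vertex) :
    T.innerEdge k ≠ s(a, midV s(a, b)) := by
  intro he
  obtain ⟨i, hi⟩ := inn_mem_innerEdge T k
  rw [he] at hi
  have h₁ := edgeLevel_half_of_mem_inner hi
  rw [← he, h.edgeLevel_innerEdge] at h₁
  exact absurd h₁ (h.level_inn i).not_lt

lemma innerEdge_injective (h : T.Regular m) : Function.Injective T.innerEdge := by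
  have hL := h.corner_ne h.level_L
  have hU := h.corner_ne h.level_U
  have hR := h.corner_ne h.level_R
  have hI := fun k => h.corner_ne (h.level_inn k)
  have mL := fun k => inn_ne_midV (T := T) k (T.side .left)
  have mU := fun k => inn_ne_midV (T := T) k (T.side .top)
  have mR := fun k => inn_ne_midV (T := T) k (T.side .right)
  have hm : ∀ i j, i ≠ j → midV (T.side i) ≠ midV (T.side j) := fun i j hij hh =>
    hij (h.side_injective (midV_injective hh))
  have h₁ := hm .left .top (by decide)
  have h₂ := hm .top .right (by decide)
  have h₃ := hm .left .right (by decide)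
  have hk : ∀ k l, k ≠ l → T.inn k ≠ T.inn l := fun k l hkl hh => hkl (inn_injective hh)
  have k₁ := hk .A .B (by decide)
  have k₂ := hk .A .C (by decide)
  have k₃ := hk .B .C (by decide)
  have h₆ := h.dr_ne_dl
  intro k l hkl
  cases k <;> cases l <;>
    simp only [Tile.innerEdge, Sym2.eq_iff, Tile.L, Tile.U, Tile.R] at * <;> grind

end Tile.Regular

/-! ### Regularity throughout a flat part -/

lemma Tile.descend_append (T : Tile) (p : List Pos) (c : Pos) :
    T.descend (p ++ [c]) = (T.descend p).sub c := by
  simp [Tile.descend]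

lemma Tile.Regular.descend {W : Tile} {m : ℤ} (h : W.Regular m) (p : List Pos) :
    (W.descend p).Regular (m + p.length) := by
  induction p using List.reverseRecOn with
  | nil => simpa [Tile.descend] using h
  | append_singleton p c ih =>
    rw [Tile.descend_append]
    have := ih.sub c
    rwa [List.length_append, List.length_singleton, Nat.cast_add, Nat.cast_one, ← add_assoc]

/-- The root of every flat part has distinct corners, and its sides have equal levels. -/
lemma IsFlatRoot.regular {W : Tile} (h : IsFlatRoot W) : ∃ m, W.Regular m := by
  obtain ⟨n, F, hF, rfl⟩ := h
  induction n generalizing F with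
  | zero =>
    obtain rfl : F = ⟨baseTile, 1⟩ := hF
    refine ⟨-1, ?_, ?_, ?_, ?_, ?_, ?_, ?_⟩
    case refine_7 =>
      intro i
      cases i <;> simp [baseTile, Tile.side, Vertex.level]
    all_goals simp [baseTile]
  | succ n ih =>
    rcases hF with ⟨F', hF', rfl⟩ | ⟨x₁, x₂, y, z₂, z₁, hp, rfl⟩
    · exact ih F' hF'
    · obtain ⟨k, -, hx, hz, -, -, hy⟩ := hp.levels
      have hn := hp.nodup
      simp only [List.nodup_cons, List.mem_cons, not_or] at hn
      have hg : ∀ v : Vertex, v.IsSideVertex → v ≠ Vertex.glued x₁ y z₁ := by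
        rintro _ hv rfl
        exact hv
      have hgl : (Vertex.glued x₁ y z₁).level = k - 1 := hx
      -- Only the corner `y` has level `k - 2`; the other three have level `k - 1`, and each side
      -- contains one of them.
      refine ⟨k - 1, ?_, ?_, ?_, ?_, ?_, ?_, ?_⟩
      case refine_7 =>
        intro i
        cases i <;> simp [Complex.gluedTile, Tile.side, hx, hy, hz, hgl]
      · exact fun h => hn.1.2.1 h.symm
      · intro h
        have := congrArg Vertex.level h
        simp only [Complex.gluedTile, hy, hgl] at this
        omega
      · exact hn.2.2.1.2.1
      · exact hg _ hp.side_x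
      · exact hn.1.2.2.2.1
      · exact fun h => hg _ hp.side_z h.symm

/-- Each passage to the next complex deepens an existing flat part by one, so every address is
eventually realized and the level of the complex plays no role in the lists. -/
lemma IsFlatRoot.isMacrotile {W : Tile} (h : IsFlatRoot W) (p : List Pos) :
    ∃ n, IsMacrotile n W p := by
  obtain ⟨n, F, hF, rfl⟩ := h
  have : ∀ d, ⟨F.root, F.depth + d⟩ ∈ complexOf (n + d) := by
    intro d
    induction d with
    | zero => exact hF
    | succ d ih => exact Or.inl ⟨_, ih, rfl⟩
  exact ⟨n + p.length, _, this p.length, rfl, Nat.le_add_left _ _⟩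

/-! ### Computing the quadruple of a macrotile -/

/-- The type of the given side in a quadruple. -/
def Env.get (q : Env) : Side → EdgeType
  | .left => q.left
  | .top => q.top
  | .right => q.right
  | .bottom => q.bottom

/-- The quadruple of a subtile. -/
def Env.sub (q : Env) : Pos → Env
  | .upperLeft => ⟨q.left, q.top, t1A, t3A⟩
  | .lowerLeft => ⟨t7A, q.left, t3B, t4A⟩
  | .upperRight => ⟨q.top, q.right, t6A, t2A⟩
  | .middle => ⟨t4B, t1B, t2B, t5B⟩
  | .lowerRight => ⟨q.right, t8A, t5A, t6B⟩
  | .lower => ⟨t8B, q.bottom, q.bottom, t7B⟩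

def rootEnv : Env := ⟨bLeft, bTop, bRight, bBottom⟩

/-- The quadruple of the macrotile with the given address. -/
def envAt (p : List Pos) : Env := p.foldl Env.sub rootEnv

@[simp] lemma envAt_append (p : List Pos) (c : Pos) : envAt (p ++ [c]) = (envAt p).sub c := by
  simp [envAt]

lemma half_swap (a b : Vertex) : s(midV s(b, a), a) = s(a, midV s(a, b)) := by
  rw [Sym2.eq_swap (a := b)]
  exact Sym2.eq_swap

/-- Every side of a subtile is either a half of a side of the macrotile, and then it inherits its
type, or an inner edge. -/
lemma sub_side (T : Tile) (q : Env) (c : Pos) (i : Side) :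
    (∃ j a b, T.side j = s(a, b) ∧ (T.sub c).side i = s(a, midV s(a, b)) ∧
      (q.sub c).get i = q.get j) ∨
    ∃ k f, facing k f = c ∧ (T.sub c).side i = T.innerEdge k ∧ (q.sub c).get i = .inner k f := by
  have hs : ∀ a b : Vertex, s(a, b) = s(b, a) := fun _ _ => Sym2.eq_swap
  cases c <;> cases i
  · exact .inl ⟨.left, T.ul, T.dl, hs _ _, half_swap _ _, rfl⟩
  · exact .inl ⟨.top, T.ul, T.ur, rfl, rfl, rfl⟩
  · exact .inr ⟨.e1, .A, rfl, rfl, rfl⟩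
  · exact .inr ⟨.e3, .A, rfl, hs _ _, rfl⟩
  · exact .inr ⟨.e7, .A, rfl, rfl, rfl⟩
  · exact .inl ⟨.left, T.dl, T.ul, rfl, rfl, rfl⟩
  · exact .inr ⟨.e3, .B, rfl, rfl, rfl⟩
  · exact .inr ⟨.e4, .A, rfl, rfl, rfl⟩
  · exact .inl ⟨.top, T.ur, T.ul, hs _ _, half_swap _ _, rfl⟩
  · exact .inl ⟨.right, T.ur, T.dr, rfl, rfl, rfl⟩
  · exact .inr ⟨.e6, .A, rfl, rfl, rfl⟩
  · exact .inr ⟨.e2, .A, rfl, hs _ _, rfl⟩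
  · exact .inr ⟨.e4, .B, rfl, hs _ _, rfl⟩
  · exact .inr ⟨.e1, .B, rfl, hs _ _, rfl⟩
  · exact .inr ⟨.e2, .B, rfl, rfl, rfl⟩
  · exact .inr ⟨.e5, .B, rfl, rfl, rfl⟩
  · exact .inl ⟨.right, T.dr, T.ur, hs _ _, half_swap _ _, rfl⟩
  · exact .inr ⟨.e8, .A, rfl, hs _ _, rfl⟩
  · exact .inr ⟨.e5, .A, rfl, hs _ _, rfl⟩
  · exact .inr ⟨.e6, .B, rfl, hs _ _, rfl⟩
  · exact .inr ⟨.e8, .B, rfl, rfl, rfl⟩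
  · exact .inl ⟨.bottom, T.dr, T.dl, rfl, rfl, rfl⟩
  · exact .inl ⟨.bottom, T.dl, T.dr, hs _ _, half_swap _ _, rfl⟩
  · exact .inr ⟨.e7, .B, rfl, hs _ _, rfl⟩

lemma facing_face_injective (k : InnerEdge) : Function.Injective (facing k) := by
  intro f g
  cases k <;> cases f <;> cases g <;> simp [facing]

lemma hasType_envAt (W : Tile) (p : List Pos) (i : Side) : HasType W p i ((envAt p).get i) := by
  induction p using List.reverseRecOn generalizing i with
  | nil => cases i <;> exact LiesOn.refl
  | append_singleton p c ih =>
    rw [envAt_append]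
    rcases sub_side (W.descend p) (envAt p) c i with
      ⟨j, a, b, hj, hi, hq⟩ | ⟨k, f, rfl, hi, hq⟩
    · have hh := ih j
      rw [hq]
      cases hg : (envAt p).get j with
      | border s =>
        rw [hg] at hh
        simp only [HasType, Tile.descend_append, hi]
        exact .half (hj ▸ hh)
      | inner k f =>
        rw [hg] at hh
        obtain ⟨p₀, p₁, rfl, hl⟩ := hh
        refine ⟨p₀, p₁ ++ [c], by simp, ?_⟩
        rw [Tile.descend_append, hi]
        exact .half (hj ▸ hl)
    · rw [hq]
      refine ⟨p, [], rfl, ?_⟩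
      rw [Tile.descend_append, hi]
      exact .refl

/-- Induction on the address: a half side hands its type back to the side of the parent, and an
inner edge lies on no macroedge but itself. -/
lemma HasType.eq_envAt {W : Tile} {m : ℤ} (hW : W.Regular m) {p : List Pos} {i : Side}
    {t : EdgeType} (h : HasType W p i t) : t = (envAt p).get i := by
  induction p using List.reverseRecOn generalizing i t with
  | nil =>
    cases t with
    | border s =>
      have := LiesOn.eq_of_edgeLevel_eq (e := W.side s) (f := W.side i) h
        (by rw [hW.edgeLevel_side, hW.edgeLevel_side])
      obtain rfl := hW.side_injective this
      cases s <;> rfl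
    | inner k f =>
      obtain ⟨p₀, p₁, hp, -⟩ := h
      simp at hp
  | append_singleton p c ih =>
    rw [envAt_append]
    have hT := hW.descend p
    rcases sub_side (W.descend p) (envAt p) c i with
      ⟨j, a, b, hj, hi, hq⟩ | ⟨k, f, hf, hi, hq⟩ <;> rw [hq]
    · refine ih ?_
      have hl : edgeLevel s(a, midV s(a, b)) = m + p.length + 1 := by
        rw [edgeLevel_half, ← hj, hT.edgeLevel_side]
      cases t with
      | border s =>
        simp only [HasType, Tile.descend_append, hi] at h ⊢
        rw [hj]
        -- A side of the root has level `m`, too small to be the half itself.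
        refine h.of_half fun he => ?_
        have := hW.edgeLevel_side s
        rw [he] at this
        omega
      | inner k f =>
        obtain ⟨p₀, p₁, hp, h⟩ := h
        rw [Tile.descend_append, hi] at h
        -- If `p₁` is empty, the edge is an inner edge of the parent, of the same level as the half,
        -- and would have to equal it. Otherwise the last letter is dropped from `p₁`.
        rcases List.eq_nil_or_concat p₁ with rfl | ⟨p₁, c', rfl⟩
        · obtain ⟨rfl, -⟩ := List.append_inj' hp rfl
          exact absurd (h.eq_of_edgeLevel_eq (by rw [hl, hT.edgeLevel_innerEdge]))
            (hT.innerEdge_ne_half _ _ _)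
        · obtain ⟨rfl, -⟩ := List.append_inj' (t₁ := [c]) (t₂ := [c'])
            (s₂ := p₀ ++ facing k f :: p₁) (by simpa using hp) rfl
          refine ⟨p₀, p₁, rfl, ?_⟩
          rw [hj]
          exact h.of_half ((hW.descend p₀).innerEdge_ne_half _ _ _)
    · have hr : ∀ e, LiesOn e ((W.descend p).innerEdge k) → e = (W.descend p).innerEdge k := by
        intro e he
        generalize hg : (W.descend p).innerEdge k = g at he
        cases he with
        | refl => rfl
        | half _ => exact absurd hg (hT.innerEdge_ne_half _ _ _)
      cases t with
      | border s =>
        simp only [HasType, Tile.descend_append, hi] at h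
        have h₁ := hW.edgeLevel_side s
        rw [hr _ h, hT.edgeLevel_innerEdge] at h₁
        omega
      | inner k' f' =>
        obtain ⟨p₀, p₁, hp, h⟩ := h
        rw [Tile.descend_append, hi] at h
        -- The level of an inner edge reveals the depth of its macrotile, so `p₀` and `p` have equal
        -- length and hence coincide.
        have h₁ := (hW.descend p₀).edgeLevel_innerEdge k'
        have h₂ := hr _ h
        rw [h₂, hT.edgeLevel_innerEdge] at h₁
        have h₃ : p.length = p₀.length := by omega
        obtain ⟨rfl, h₄⟩ := List.append_inj hp h₃
        obtain rfl := hT.innerEdge_injective h₂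
        obtain rfl : f' = f := facing_face_injective k' (by
          rw [hf]; exact (List.cons.inj h₄).1.symm)
        rfl

lemma hasEnv_iff {W : Tile} (hW : IsFlatRoot W) (p : List Pos) (q : Env) :
    HasEnv W p q ↔ q = envAt p := by
  obtain ⟨m, hm⟩ := hW.regular
  constructor
  · rintro ⟨h₁, h₂, h₃, h₄⟩
    exact Env.ext (h₁.eq_envAt hm) (h₂.eq_envAt hm) (h₃.eq_envAt hm) (h₄.eq_envAt hm)
  · rintro rfl
    exact ⟨hasType_envAt W p .left, hasType_envAt W p .top, hasType_envAt W p .right,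
      hasType_envAt W p .bottom⟩

/-! ### Location of a macrotile in the flat part -/

lemma IsDirectDescendant.tail_eq {c : Pos} {p : List Pos} (h : IsDirectDescendant [c] p) :
    ∀ x ∈ p.tail, x = .upperLeft := by
  -- Nonemptiness is carried along because the tail of `p ++ [c]` splits only for nonempty `p`.
  suffices h' : p ≠ [] ∧ ∀ x ∈ p.tail, x = .upperLeft from h'.2
  induction h with
  | sub => simp
  | step _ ih =>
    refine ⟨by simp, fun x hx => ?_⟩
    rw [List.tail_append_of_ne_nil ih.1, List.mem_append] at hx
    rcases hx with hx | hx
    · exact ih.2 x hx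
    · simpa using hx

lemma isRemaining_of_mem_tail {p : List Pos} (h : ∃ x ∈ p.tail, x ≠ .upperLeft) :
    IsRemaining p := by
  obtain ⟨x, hx, hne⟩ := h
  refine ⟨by rintro rfl; simp at hx, fun c => ⟨by rintro rfl; simp at hx, fun hd => ?_⟩⟩
  exact hne (hd.tail_eq x hx)

lemma IsRemaining.append {p : List Pos} (h : IsRemaining p) (c : Pos) :
    IsRemaining (p ++ [c]) := by
  refine ⟨by simp, fun d => ⟨fun hd => h.1 ?_, fun hd => ?_⟩⟩
  · exact (List.append_inj' (s₂ := []) hd rfl).1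
  · generalize hr : p ++ [c] = r at hd
    cases hd with
    | sub => exact (h.2 d).1 (List.append_inj' hr rfl).1
    | step hd => exact (h.2 d).2 ((List.append_inj' hr rfl).1 ▸ hd)

lemma IsDirectDescendant.ne_nil {p r : List Pos} (h : IsDirectDescendant p r) : r ≠ [] := by
  cases h <;> simp

lemma isRemaining_append {d : Pos} {p : List Pos} (h : p = [d] ∨ IsDirectDescendant [d] p)
    {c : Pos} (hc : c ≠ .upperLeft) : IsRemaining (p ++ [c]) := by
  refine isRemaining_of_mem_tail ⟨c, ?_, hc⟩
  have : p ≠ [] := by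
    rcases h with rfl | h
    · simp
    · exact h.ne_nil
  rw [List.tail_append_of_ne_nil this]
  simp

/-- Passing to the upper left subtile keeps the left and top types and resets the other two to
`t1A`, `t3A`, so repeating it changes nothing. -/
lemma envAt_directDescendant {c : Pos} {p : List Pos} (h : IsDirectDescendant [c] p) :
    envAt p = (rootEnv.sub c).sub .upperLeft := by
  induction h with
  | sub => rfl
  | step _ ih => rw [envAt_append, ih]; rfl

/-! ### The reachable quadruples -/

def positions : List Pos := [.upperLeft, .lowerLeft, .upperRight, .middle, .lowerRight, .lower]

lemma mem_positions (c : Pos) : c ∈ positions := by cases c <;> decide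

/-- The quadruples of the remaining macrotiles. -/
def RemEnv (q : Env) : Prop := CaseA q ∨ LeftEnv q ∨ TopEnv q

def innerTypes : List EdgeType :=
  [.e1, .e2, .e3, .e4, .e5, .e6, .e7, .e8].flatMap fun k => [.inner k .A, .inner k .B]

def borderTypes : List EdgeType := [bLeft, bTop, bRight, bBottom]

lemma mem_innerTypes (t : EdgeType) : t ∈ innerTypes ↔ t.IsInner := by
  constructor
  · simp only [innerTypes, List.mem_flatMap]
    rintro ⟨k, -, h⟩
    simp only [List.mem_cons, List.not_mem_nil, or_false] at h
    rcases h with rfl | rfl <;> exact ⟨_, _, rfl⟩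
  · rintro ⟨k, f, rfl⟩
    cases k <;> cases f <;> decide

lemma mem_borderTypes (t : EdgeType) : t ∈ borderTypes ↔ t.IsBorder := by
  constructor
  · intro h
    simp only [borderTypes, List.mem_cons, List.not_mem_nil, or_false] at h
    rcases h with rfl | rfl | rfl | rfl <;> exact ⟨_, rfl⟩
  · rintro ⟨s, rfl⟩
    cases s <;> decide

/-- All quadruples satisfying `RemEnv`. -/
def remEnvs : List Env :=
  ((innerTypes ++ borderTypes).flatMap fun x =>
    [⟨t7A, x, t3B, t4A⟩, ⟨t7A, x, t1A, t3A⟩, ⟨x, t1A, t6A, t2A⟩, ⟨x, t1A, t1A, t3A⟩,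
      ⟨x, t3B, t6A, t2A⟩, ⟨x, t3B, t1A, t3A⟩]) ++
  ([t2A, t3A, t4A, t5B, t6B, t7B].flatMap fun t =>
    [⟨t8B, t, t, t7B⟩, ⟨t8B, t, t1A, t3A⟩]) ++
  ([t2A, t3A, t4A, t5B, t6B, t7B, bBottom].flatMap fun t =>
    [⟨t, t, t6A, t2A⟩, ⟨t, t, t1A, t3A⟩]) ++
  ((bRight :: bBottom :: innerTypes.filter (· ∉ [t1B, t4B, t7A, t8A, t8B])).flatMap fun l =>
    [⟨l, t6A, t6A, t2A⟩, ⟨l, t6A, t1A, t3A⟩]) ++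
  ((bBottom :: innerTypes.filter (· ∉ [t1B, t4B, t7A, t8A, t8B])).flatMap fun l =>
    [⟨l, t8A, t5A, t6B⟩, ⟨l, t8A, t1A, t3A⟩]) ++
  [⟨t4B, t1B, t2B, t5B⟩, ⟨t4B, t1B, t1A, t3A⟩, ⟨t1B, t2B, t6A, t2A⟩, ⟨t1B, t2B, t1A, t3A⟩,
    ⟨t8A, t5A, t6A, t2A⟩, ⟨t8A, t5A, t1A, t3A⟩]

lemma sub_mem_remEnvs_of_mem : ∀ q ∈ remEnvs, ∀ c ∈ positions, q.sub c ∈ remEnvs := by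
  decide +kernel

/-- The first remaining macrotile on a descent is entered from a subtile of the root or from a
direct descendant of one, by a passage other than the upper left one. -/
lemma start_mem_remEnvs : ∀ d ∈ positions, ∀ c ∈ positions, c ≠ .upperLeft →
    (rootEnv.sub d).sub c ∈ remEnvs ∧ ((rootEnv.sub d).sub .upperLeft).sub c ∈ remEnvs := by
  decide +kernel

lemma mem_remEnvs (q : Env) : q ∈ remEnvs ↔ RemEnv q := by
  constructor
  · intro h
    simp only [remEnvs, List.mem_append, List.mem_flatMap, List.mem_cons, List.mem_filter,
      mem_innerTypes, mem_borderTypes, List.not_mem_nil, or_false, decide_eq_true_eq] at h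
    have hl : ∀ {l}, l.IsInner ∧ ¬ (l = t1B ∨ l = t4B ∨ l = t7A ∨ l = t8A ∨ l = t8B) →
        l ∉ [t1B, t4B, t7A, t8A, t8B] := fun h => by simpa using h.2
    rcases h with ((((h | h) | h) | h) | h) | h
    · obtain ⟨x, hx | hx, rfl | rfl | rfl | rfl | rfl | rfl⟩ := h
      exacts [.inl (.A1 _ hx), .inl (.A2 _ hx), .inl (.A7 _ hx), .inl (.A8 _ hx),
        .inl (.A13 _ hx), .inl (.A14 _ hx), .inr (.inr (.c1 _ hx)), .inr (.inr (.c2 _ hx)),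
        .inr (.inl (.c2 _ hx)), .inr (.inl (.c4 _ hx)), .inr (.inl (.c1 _ hx)),
        .inr (.inl (.c3 _ hx))]
    · obtain ⟨t, ht, rfl | rfl⟩ := h
      exacts [.inl (.A3 _ (by simpa using ht)), .inl (.A4 _ (by simpa using ht))]
    · obtain ⟨t, ht, hq⟩ := h
      by_cases hb : t = bBottom
      · subst hb
        obtain rfl | rfl := hq
        exacts [.inr (.inl .c7), .inr (.inl .c8)]
      · have ht' : t ∈ [t2A, t3A, t4A, t5B, t6B, t7B] := by simpa [hb] using ht
        obtain rfl | rfl := hq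
        exacts [.inl (.A5 _ ht'), .inl (.A6 _ ht')]
    · obtain ⟨l, rfl | rfl | h, rfl | rfl⟩ := h
      exacts [.inr (.inl (.c5 _ (by simp))), .inr (.inl (.c6 _ (by simp))),
        .inr (.inl (.c5 _ (by simp))), .inr (.inl (.c6 _ (by simp))),
        .inl (.A17 _ h.1 (hl h)), .inl (.A18 _ h.1 (hl h))]
    · obtain ⟨l, rfl | h, rfl | rfl⟩ := h
      exacts [.inr (.inl .c9), .inr (.inl .c10), .inl (.A19 _ h.1 (hl h)),
        .inl (.A20 _ h.1 (hl h))]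
    · obtain rfl | rfl | rfl | rfl | rfl | rfl := h
      exacts [.inl .A9, .inl .A10, .inl .A11, .inl .A12, .inl .A15, .inl .A16]
  · intro h
    simp only [remEnvs, List.mem_append, List.mem_flatMap, List.mem_cons, List.mem_filter,
      mem_innerTypes, mem_borderTypes, List.not_mem_nil, or_false, decide_eq_true_eq]
    rcases h with h | h | h <;> cases h <;> simp_all <;> grind

lemma RemEnv.sub {q : Env} (h : RemEnv q) (c : Pos) : RemEnv (q.sub c) := by
  rw [← mem_remEnvs] at h ⊢
  exact sub_mem_remEnvs_of_mem q h c (mem_positions c)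

/-- The possible locations of a macrotile in the flat part. -/
lemma location_cases (p : List Pos) : p = [] ∨ (∃ c, p = [c]) ∨
    (∃ c, IsDirectDescendant [c] p) ∨ (IsRemaining p ∧ RemEnv (envAt p)) := by
  have start := fun d c => start_mem_remEnvs d (mem_positions d) c (mem_positions c)
  simp only [mem_remEnvs] at start
  induction p using List.reverseRecOn with
  | nil => exact .inl rfl
  | append_singleton p c ih =>
    refine .inr ?_
    rcases ih with rfl | ⟨d, rfl⟩ | ⟨d, hd⟩ | ⟨hp, hq⟩
    · exact .inl ⟨c, rfl⟩
    · by_cases hc : c = .upperLeft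
      · subst hc
        exact .inr (.inl ⟨d, .sub⟩)
      · exact .inr (.inr ⟨isRemaining_append (.inl rfl) hc, (start d c hc).1⟩)
    · by_cases hc : c = .upperLeft
      · subst hc
        exact .inr (.inl ⟨d, .step hd⟩)
      · refine .inr (.inr ⟨isRemaining_append (.inr hd) hc, ?_⟩)
        rw [envAt_append, envAt_directDescendant hd]
        exact (start d c hc).2
    · rw [envAt_append]
      exact .inr (.inr ⟨hp.append c, hq.sub c⟩)

lemma IsRemaining.remEnv {p : List Pos} (h : IsRemaining p) : RemEnv (envAt p) := by
  rcases location_cases p with hp | ⟨c, hp⟩ | ⟨c, hp⟩ | hp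
  exacts [absurd hp h.1, absurd hp (h.2 c).1, absurd hp (h.2 c).2, hp.2]

/-! ### Realizing every quadruple of the list -/

/-- The quadruple is that of a remaining macrotile. -/
def IsRemainingEnv (q : Env) : Prop := ∃ p, IsRemaining p ∧ envAt p = q

lemma IsRemainingEnv.sub {q : Env} (h : IsRemainingEnv q) (c : Pos) :
    IsRemainingEnv (q.sub c) := by
  obtain ⟨p, hp, rfl⟩ := h
  exact ⟨p ++ [c], hp.append c, envAt_append p c⟩

lemma isRemainingEnv_sub {p : List Pos} {c : Pos} (hp : p ≠ []) (hc : c ≠ .upperLeft) :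
    IsRemainingEnv ((envAt p).sub c) := by
  refine ⟨p ++ [c], isRemaining_of_mem_tail ⟨c, ?_, hc⟩, envAt_append p c⟩
  rw [List.tail_append_of_ne_nil hp]
  simp

/-- The addresses of length at most `n`. -/
def words : ℕ → List (List Pos)
  | 0 => [[]]
  | n + 1 => words n ++ (words n).flatMap fun p => positions.map fun c => p ++ [c]

lemma exists_word_left : ∀ x ∈ innerTypes ++ borderTypes, ∃ p ∈ words 3,
    (∃ c ∈ p.tail, c ≠ .upperLeft) ∧ (envAt p).left = x := by
  decide +kernel

/-- These six types are the bottoms that `Env.sub` assigns to the six positions. The lower subtile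
then copies the bottom type to its top and right sides. -/
lemma exists_word_bottom : ∀ t ∈ [t2A, t3A, t4A, t5B, t6B, t7B], ∃ p ∈ words 3,
    p ≠ [] ∧ (envAt p).bottom = t := by
  decide +kernel

/-- The right type `t6A` occurs only at upper right subtiles, whose top is the right side of the
parent. The five excluded types never occur on a right side. -/
lemma exists_word_top :
    ∀ l ∈ bRight :: bBottom :: innerTypes.filter (· ∉ [t1B, t4B, t7A, t8A, t8B]),
    ∃ p ∈ words 3, p ≠ [] ∧ (envAt p).top = l ∧ (envAt p).right = t6A := by
  decide +kernel

/-- The type `bRight` is absent here: only the root has it as its right type. -/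
lemma exists_word_right :
    ∀ l ∈ bBottom :: innerTypes.filter (· ∉ [t1B, t4B, t7A, t8A, t8B]),
    ∃ p ∈ words 3, p ≠ [] ∧ (envAt p).right = l := by
  decide +kernel

lemma RemEnv.isRemainingEnv {q : Env} (h : RemEnv q) : IsRemainingEnv q := by
  rw [← mem_remEnvs, remEnvs] at h
  rcases List.mem_append.1 h with h | h
  on_goal 1 => rcases List.mem_append.1 h with h | h
  on_goal 1 => rcases List.mem_append.1 h with h | h
  on_goal 1 => rcases List.mem_append.1 h with h | h
  on_goal 1 => rcases List.mem_append.1 h with h | h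
  on_goal 6 =>
    have h₁ : IsRemainingEnv ⟨t4B, t1B, t2B, t5B⟩ :=
      isRemainingEnv_sub (p := [.upperLeft]) (c := .middle) (by simp) (by simp)
    have h₂ : IsRemainingEnv ⟨t8A, t5A, t6A, t2A⟩ :=
      isRemainingEnv_sub (p := [.lowerRight]) (c := .upperRight) (by simp) (by simp)
    simp only [List.mem_cons, List.not_mem_nil, or_false] at h
    obtain rfl | rfl | rfl | rfl | rfl | rfl := h
    exacts [h₁, h₁.sub .upperLeft, h₁.sub .upperRight, (h₁.sub .upperRight).sub .upperLeft, h₂,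
      h₂.sub .upperLeft]
  all_goals
    obtain ⟨x, hx, hq⟩ := List.mem_flatMap.1 h
    simp only [List.mem_cons, List.not_mem_nil, or_false] at hq
  · obtain ⟨p, -, hp, rfl⟩ := exists_word_left x hx
    -- The lower left passage moves the left type to the top; an upper right passage moves it back
    -- to the left, next to `t3B` or `t1A`.
    have h₁ : IsRemainingEnv ⟨t7A, (envAt p).left, t3B, t4A⟩ :=
      IsRemainingEnv.sub ⟨p, isRemaining_of_mem_tail hp, rfl⟩ .lowerLeft
    have h₂ := h₁.sub .upperLeft
    have h₃ := h₁.sub .upperRight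
    have h₄ := h₂.sub .upperRight
    obtain rfl | rfl | rfl | rfl | rfl | rfl := hq
    exacts [h₁, h₂, h₄, h₄.sub .upperLeft, h₃, h₃.sub .upperLeft]
  · obtain ⟨p, -, hp, rfl⟩ := exists_word_bottom x hx
    have h₁ := isRemainingEnv_sub hp (c := .lower) (by simp)
    obtain rfl | rfl := hq
    exacts [h₁, h₁.sub .upperLeft]
  · have h₁ : IsRemainingEnv ⟨x, x, t6A, t2A⟩ := by
      by_cases hb : x = bBottom
      · subst hb
        exact isRemainingEnv_sub (p := [.lower]) (c := .upperRight) (by simp) (by simp)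
      · obtain ⟨p, -, hp, rfl⟩ := exists_word_bottom x (by simpa [hb] using hx)
        exact (isRemainingEnv_sub hp (c := .lower) (by simp)).sub .upperRight
    obtain rfl | rfl := hq
    exacts [h₁, h₁.sub .upperLeft]
  · obtain ⟨p, -, hp, rfl, hr⟩ := exists_word_top x hx
    have h₁ := isRemainingEnv_sub hp (c := .upperRight) (by simp)
    simp only [Env.sub, hr] at h₁
    obtain rfl | rfl := hq
    exacts [h₁, h₁.sub .upperLeft]
  · obtain ⟨p, -, hp, rfl⟩ := exists_word_right x hx
    have h₁ := isRemainingEnv_sub hp (c := .lowerRight) (by simp)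
    obtain rfl | rfl := hq
    exacts [h₁, h₁.sub .upperLeft]

lemma isRemainingEnv_iff (q : Env) : IsRemainingEnv q ↔ RemEnv q := by
  refine ⟨?_, RemEnv.isRemainingEnv⟩
  rintro ⟨p, hp, rfl⟩
  exact hp.remEnv

/-! ### Sorting the quadruples by inner and border types -/

lemma EdgeType.IsInner.not_isBorder {t : EdgeType} (h : t.IsInner) : ¬ t.IsBorder := by
  rintro ⟨s, rfl⟩
  simp [IsInner] at h

lemma LeftEnv.left_isBorder {q : Env} (h : LeftEnv q) : q.left.IsBorder := by
  cases h <;> simp_all [EdgeType.IsBorder] <;> grind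

lemma TopEnv.top_isBorder {q : Env} (h : TopEnv q) : q.top.IsBorder := by
  cases h <;> simp_all [EdgeType.IsBorder]

lemma TopEnv.leftEnv {q : Env} (h : TopEnv q) (hl : q.left.IsBorder) : LeftEnv q := by
  cases h
  case c3 => exact .c7
  case c4 => exact .c8
  all_goals simp [EdgeType.IsBorder] at hl

lemma LeftEnv.topEnv {q : Env} (h : LeftEnv q) (ht : q.top.IsBorder) : TopEnv q := by
  cases h
  case c7 => exact .c3
  case c8 => exact .c4
  all_goals simp [EdgeType.IsBorder] at ht

lemma CaseA.left_isInner {q : Env} (h : CaseA q) : q.left.IsInner := by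
  cases h <;> first | assumption | exact ⟨_, _, rfl⟩ | (simp_all [EdgeType.IsInner]; grind)

lemma CaseA.top_isInner {q : Env} (h : CaseA q) : q.top.IsInner := by
  cases h <;> first | assumption | exact ⟨_, _, rfl⟩ | (simp_all [EdgeType.IsInner]; grind)

lemma LeftEnv.caseB {q : Env} (h : LeftEnv q) : CaseB q := by
  cases h
  case c1 h => exact .B11 _ h
  case c2 h => exact .B17 _ h
  case c3 h => exact .B12 _ h
  case c4 h => exact .B18 _ h
  case c5 h =>
    simp only [List.mem_cons, List.not_mem_nil, or_false] at h
    rcases h with rfl | rfl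
    exacts [.B13, .B15]
  case c6 h =>
    simp only [List.mem_cons, List.not_mem_nil, or_false] at h
    rcases h with rfl | rfl
    exacts [.B14, .B16]
  case c7 => exact .B19
  case c8 => exact .B20
  case c9 => exact .B7 _ (by simp)
  case c10 => exact .B8 _ (by simp)

lemma TopEnv.caseB {q : Env} (h : TopEnv q) : CaseB q := by
  cases h
  case c1 h => exact .B3 _ h
  case c2 h => exact .B4 _ h
  case c3 => exact .B19
  case c4 => exact .B20

/-- The quadruples of the macrotiles of the flat part that are not remaining. -/
inductive EarlyEnv : Env → Prop
  | root : EarlyEnv rootEnv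
  | sub (c : Pos) : EarlyEnv (rootEnv.sub c)
  | desc (c : Pos) : EarlyEnv ((rootEnv.sub c).sub .upperLeft)

lemma exists_envAt_iff (q : Env) : (∃ p, envAt p = q) ↔ EarlyEnv q ∨ RemEnv q := by
  constructor
  · rintro ⟨p, rfl⟩
    rcases location_cases p with rfl | ⟨c, rfl⟩ | ⟨c, hp⟩ | hp
    · exact .inl .root
    · exact .inl (.sub c)
    · rw [envAt_directDescendant hp]
      exact .inl (.desc c)
    · exact .inr hp.2
  · rintro (h | h)
    · cases h with
      | root => exact ⟨[], rfl⟩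
      | sub c => exact ⟨[c], rfl⟩
      | desc c => exact ⟨[c, .upperLeft], rfl⟩
    · obtain ⟨p, -, h⟩ := h.isRemainingEnv
      exact ⟨p, h⟩

lemma EarlyEnv.caseA_or_caseB {q : Env} (h : EarlyEnv q) : CaseA q ∨ CaseB q := by
  cases h with
  | root => exact .inr .B1
  | sub c =>
    cases c
    exacts [.inr .B2, .inr (.B3 _ ⟨_, rfl⟩), .inr .B5, .inl .A9, .inr (.B7 bRight (by simp)), .inr .B9]
  | desc c =>
    cases c
    exacts [.inr .B2, .inr (.B4 _ ⟨_, rfl⟩), .inr .B6, .inl .A10, .inr (.B8 bRight (by simp)),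
      .inr .B10]

/-- Some quadruples occur at both kinds of places, for instance `B3` with `bLeft`; one realization
suffices. In `B7` and `B8` the type `bRight` is early and `bBottom` remaining. -/
lemma CaseB.earlyEnv_or_remEnv {q : Env} (h : CaseB q) : EarlyEnv q ∨ RemEnv q := by
  cases h
  case B1 => exact .inl .root
  case B2 => exact .inl (.sub .upperLeft)
  case B3 h => exact .inr (.inr (.inr (.c1 _ h)))
  case B4 h => exact .inr (.inr (.inr (.c2 _ h)))
  case B5 => exact .inl (.sub .upperRight)
  case B6 => exact .inl (.desc .upperRight)
  case B7 h =>
    simp only [List.mem_cons, List.not_mem_nil, or_false] at h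
    rcases h with rfl | rfl
    exacts [.inl (.sub .lowerRight), .inr (.inr (.inl .c9))]
  case B8 h =>
    simp only [List.mem_cons, List.not_mem_nil, or_false] at h
    rcases h with rfl | rfl
    exacts [.inl (.desc .lowerRight), .inr (.inr (.inl .c10))]
  case B9 => exact .inl (.sub .lower)
  case B10 => exact .inl (.desc .lower)
  case B11 h => exact .inr (.inr (.inl (.c1 _ h)))
  case B12 h => exact .inr (.inr (.inl (.c3 _ h)))
  case B13 => exact .inr (.inr (.inl (.c5 _ (by simp))))
  case B14 => exact .inr (.inr (.inl (.c6 _ (by simp))))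
  case B15 => exact .inr (.inr (.inl (.c5 _ (by simp))))
  case B16 => exact .inr (.inr (.inl (.c6 _ (by simp))))
  case B17 h => exact .inr (.inr (.inl (.c2 _ h)))
  case B18 h => exact .inr (.inr (.inl (.c4 _ h)))
  case B19 => exact .inr (.inr (.inl .c7))
  case B20 => exact .inr (.inr (.inl .c8))

lemma CaseB.isBorder {q : Env} (h : CaseB q) : q.left.IsBorder ∨ q.top.IsBorder := by
  cases h <;> simp_all [EdgeType.IsBorder] <;> grind

/-- The quadruples of the macrotiles of the flat part are those of the two lists. -/
lemma exists_envAt_iff_caseA_or_caseB (q : Env) : (∃ p, envAt p = q) ↔ CaseA q ∨ CaseB q := by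
  rw [exists_envAt_iff]
  constructor
  · rintro (h | h | h | h)
    exacts [h.caseA_or_caseB, .inl h, .inr h.caseB, .inr h.caseB]
  · rintro (h | h)
    exacts [.inr (.inl h), h.earlyEnv_or_remEnv]

end MacroTiling

open MacroTiling

/-- In every flat part (the initial square or a glued macrotile `W`, with all the macrotiles that
its subdivisions produce) each macrotile has exactly one quadruple of edge types; the quadruples
with inner left and top edges are exactly those of the list A1-A20, the quadruples with a border
left or top edge are exactly those of the list B1-B20, and the latter are distributed over the
five possible locations of the macrotile as described. -/
theorem mainTheorem8 (W : Tile) (hW : IsFlatRoot W) :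
    (∀ n p, IsMacrotile n W p → ∃! q : Env, HasEnv W p q) ∧
    (∀ q : Env, (∃ n p, IsMacrotile n W p ∧ HasEnv W p q ∧ q.left.IsInner ∧ q.top.IsInner) ↔
      CaseA q) ∧
    (∀ q : Env, (∃ n p, IsMacrotile n W p ∧ HasEnv W p q ∧ (q.left.IsBorder ∨ q.top.IsBorder)) ↔
      CaseB q) ∧
    (∀ q : Env, HasEnv W [] q ↔ q = ⟨bLeft, bTop, bRight, bBottom⟩) ∧
    (∀ c : Pos, c ≠ .middle → ∀ q : Env, HasEnv W [c] q ↔ SubEnv c q) ∧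
    (∀ c : Pos, c ≠ .middle → ∀ p, IsDirectDescendant [c] p →
      ∀ q : Env, HasEnv W p q ↔ DescEnv c q) ∧
    (∀ q : Env, (∃ n p, IsMacrotile n W p ∧ IsRemaining p ∧ HasEnv W p q ∧ q.left.IsBorder) ↔
      LeftEnv q) ∧
    (∀ q : Env, (∃ n p, IsMacrotile n W p ∧ IsRemaining p ∧ HasEnv W p q ∧ q.top.IsBorder) ↔
      TopEnv q) := by
  -- Both the level `n` and the geometry are eliminated here: every statement becomes one about the
  -- values of `envAt`.
  have key : ∀ (q : Env) (P : List Pos → Prop) (Q : Prop),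
      (∃ n p, IsMacrotile n W p ∧ P p ∧ HasEnv W p q ∧ Q) ↔ (∃ p, P p ∧ envAt p = q) ∧ Q := by
    intro q P Q
    constructor
    · rintro ⟨n, p, -, hP, hp, hQ⟩
      exact ⟨⟨p, hP, ((hasEnv_iff hW p q).1 hp).symm⟩, hQ⟩
    · rintro ⟨⟨p, hP, hp⟩, hQ⟩
      obtain ⟨n, hn⟩ := hW.isMacrotile p
      exact ⟨n, p, hn, hP, (hasEnv_iff hW p q).2 hp.symm, hQ⟩
  have key' : ∀ (q : Env) (Q : Prop),
      (∃ n p, IsMacrotile n W p ∧ HasEnv W p q ∧ Q) ↔ (CaseA q ∨ CaseB q) ∧ Q := by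
    intro q Q
    rw [← exists_envAt_iff_caseA_or_caseB]
    simpa using key q (fun _ => True) Q
  refine ⟨?_, ?_, ?_, ?_, ?_, ?_, ?_, ?_⟩
  · intro n p _
    simp only [hasEnv_iff hW]
    exact ⟨_, rfl, fun _ h => h⟩
  · intro q
    rw [key']
    constructor
    · rintro ⟨h | h, hl, ht⟩
      · exact h
      · exact (h.isBorder.elim hl.not_isBorder ht.not_isBorder).elim
    · exact fun h => ⟨.inl h, h.left_isInner, h.top_isInner⟩
  · intro q
    rw [key']
    constructor
    · rintro ⟨h | h, hb⟩
      · exact (hb.elim h.left_isInner.not_isBorder h.top_isInner.not_isBorder).elim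
      · exact h
    · exact fun h => ⟨.inr h, h.isBorder⟩
  · exact fun q => hasEnv_iff hW [] q
  · intro c hc q
    rw [hasEnv_iff hW]
    constructor
    · rintro rfl
      cases c
      exacts [.upperLeft, .lowerLeft, .upperRight, absurd rfl hc, .lowerRight, .lower]
    · intro h
      cases h <;> rfl
  · intro c hc p hp q
    rw [hasEnv_iff hW, envAt_directDescendant hp]
    constructor
    · rintro rfl
      cases c
      exacts [.upperLeft, .lowerLeft, .upperRight, absurd rfl hc, .lowerRight, .lower]
    · intro h
      cases h <;> rfl
  · intro q
    rw [key]
    change IsRemainingEnv q ∧ _ ↔ _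
    rw [isRemainingEnv_iff]
    constructor
    · rintro ⟨h | h | h, hl⟩
      exacts [absurd hl h.left_isInner.not_isBorder, h, h.leftEnv hl]
    · exact fun h => ⟨.inr (.inl h), h.left_isBorder⟩
  · intro q
    rw [key]
    change IsRemainingEnv q ∧ _ ↔ _
    rw [isRemainingEnv_iff]
    constructor
    · rintro ⟨h | h | h, ht⟩
      exacts [absurd ht h.top_isInner.not_isBorder, h.topEnv ht, h]
    · exact fun h => ⟨.inr (.inr h), h.top_isBorder⟩
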